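/- Let $\Delta\subset\mathbb C$ be the open unit disc and let $\rho_\Delta(z,w)=\operatorname{artanh}\left|\frac{z-w}{1-\bar z w}\right|$ be its Poincaré distance. For a domain (non-empty connected open set) $\Omega\subset\mathbb C^d$, let $K_\Omega(x,y)$ be the Kobayashi distance, i.e. the infimum of $\sum_{i=1}^n\rho_\Delta(\zeta_{i-1},\zeta_i)$ over all $n\ge 1$, all holomorphic maps $\phi_1,\dots,\phi_n:\Delta\to\Omega$ and all $\zeta_0,\dots,\zeta_n\in\Delta$ with $\phi_1(\zeta_0)=x$, $\phi_n(\zeta_n)=y$ and $\phi_i(\zeta_i)=\phi_{i+1}(\zeta_i)$ for $1\le i<n$. Let $k_\Omega(x;v)$ be the Kobayashi–Royden metric, i.e. the infimum of $|\xi|$ over all holomorphic $\phi:\Delta\to\Omega$ and $\xi\in\mathbb C$ with $\phi(0)=x$ and $\phi'(0)\xi=v$. Write $\delta_\Omega(x)$ for the Euclidean distance from $x$ to $\partial\Omega$ and $$M_\Omega(r)=\sup\left\{\frac1{k_\Omega(x;v)} : x\in\Omega,\ \delta_\Omega(x)\le r,\ \|v\|=1\right\}.$$ A bounded domain $\Omega\subset\mathbb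 C^d$ is called a Goldilocks domain if (1) $\int_0^\epsilon \frac1r M_\Omega(r)\,dr<\infty$ for some $\epsilon>0$, and (2) for each $x_0\in\Omega$ there are constants $C,\alpha>0$ such that $K_\Omega(x_0,x)\le C+\alpha\log\frac1{\delta_\Omega(x)}$ for all $x\in\Omega$. **Theorem.** Let $\Omega\subset\mathbb C^d$ be a Goldilocks domain and let $f:\Omega\to\Omega$ be a map that is 1-Lipschitz for the Kobayashi distance, i.e. $K_\Omega(f(x),f(y))\le K_\Omega(x,y)$ for all $x,y\in\Omega$. Suppose that $\lim_{n\to\infty}K_\Omega(f^n(o),o)=\infty$ for some $o\in\Omega$, where $f^n$ is the $n$-th iterate of $f$. Then $\lim_{n\to\infty}K_\Omega(f^n(o'),o')=\infty$ for every $o'\in\Omega$, and there exists $\xi\in\partial\Omega$ such that $\lim_{n\to\infty}f^n(x)=\xi$ for all $x\in\Omega$. -/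

import Mathlib

open Set Filter Topology MeasureTheory

noncomputable section

namespace Kobayashi

/-- `ℂ^d` with the standard Euclidean norm. -/
abbrev Cn (d : ℕ) : Type := EuclideanSpace ℂ (Fin d)

/-- The open unit disc in `ℂ`. -/
def disc : Set ℂ := Metric.ball 0 1

/-- The Poincaré distance of the open unit disc, normalized so that its infinitesimal form is
`|dz| / (1 - |z|^2)`. -/
def poincareDist (z w : ℂ) : ℝ :=
  Real.artanh ‖(z - w) / (1 - (starRingEnd ℂ) z * w)‖

/-- `φ` restricts to a holomorphic map from the open unit disc into `Ω`. -/
structure IsHolDisc {d : ℕ} (Ω : Set (Cn d)) (φ : ℂ → Cn d) : Prop where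
  differentiableOn : DifferentiableOn ℂ φ disc
  mapsTo : MapsTo φ disc Ω

/-- `(φ 1, …, φ n; ζ 0, …, ζ n)` is an analytic chain in `Ω` joining `x` to `y`; the values of the
sequences `φ` and `ζ` at other indices play no role. -/
structure IsAnalyticChain {d : ℕ} (Ω : Set (Cn d)) (x y : Cn d)
    (n : ℕ) (φ : ℕ → ℂ → Cn d) (ζ : ℕ → ℂ) : Prop where
  one_le : 1 ≤ n
  isHolDisc : ∀ i, 1 ≤ i → i ≤ n → IsHolDisc Ω (φ i)
  mem_disc : ∀ i, i ≤ n → ζ i ∈ disc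
  start : φ 1 (ζ 0) = x
  finish : φ n (ζ n) = y
  link : ∀ i, 1 ≤ i → i < n → φ i (ζ i) = φ (i + 1) (ζ i)

/-- The Kobayashi (pseudo-)distance `K_Ω(x, y)`: the infimum of the Poincaré lengths of the analytic
chains in `Ω` joining `x` to `y`. (In a domain any two points are joined by such a chain.) -/
def kobDist {d : ℕ} (Ω : Set (Cn d)) (x y : Cn d) : ℝ :=
  sInf {L : ℝ | ∃ (n : ℕ) (φ : ℕ → ℂ → Cn d) (ζ : ℕ → ℂ), IsAnalyticChain Ω x y n φ ζ ∧
    L = ∑ i ∈ Finset.range n, poincareDist (ζ i) (ζ (i + 1))}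

/-- The Kobayashi–Royden (pseudo-)metric `k_Ω(x; v)`: the infimum of `|ξ|` over the holomorphic maps
`φ` from the unit disc to `Ω` and the `ξ ∈ ℂ` with `φ(0) = x` and `dφ(0) ξ = v`. -/
def kobMetric {d : ℕ} (Ω : Set (Cn d)) (x v : Cn d) : ℝ :=
  sInf {t : ℝ | ∃ (φ : ℂ → Cn d) (ξ : ℂ), IsHolDisc Ω φ ∧ φ 0 = x ∧ ξ • deriv φ 0 = v ∧ t = ‖ξ‖}

/-- The Euclidean distance from `x` to the boundary of `Ω`. -/
def bdryDist {d : ℕ} (Ω : Set (Cn d)) (x : Cn d) : ℝ :=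
  Metric.infDist x (frontier Ω)

/-- `M_Ω(r)`, the supremum of `1 / k_Ω(x; v)` over the `x ∈ Ω` with `δ_Ω(x) ≤ r` and the unit
vectors `v`. (For a bounded domain `Ω` these numbers are bounded above.) -/
def growth {d : ℕ} (Ω : Set (Cn d)) (r : ℝ) : ℝ :=
  sSup {t : ℝ | ∃ x v : Cn d, x ∈ Ω ∧ bdryDist Ω x ≤ r ∧ ‖v‖ = 1 ∧ t = 1 / kobMetric Ω x v}

/-- `Ω ⊆ ℂ^d` is a Goldilocks domain. -/
structure IsGoldilocks {d : ℕ} (Ω : Set (Cn d)) : Prop where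
  isOpen : IsOpen Ω
  isConnected : IsConnected Ω
  isBounded : Bornology.IsBounded Ω
  integrable : ∃ ε : ℝ, 0 < ε ∧ IntegrableOn (fun r : ℝ => 1 / r * growth Ω r) (Ioo 0 ε)
  dist_le : ∀ x₀ ∈ Ω, ∃ C α : ℝ, 0 < C ∧ 0 < α ∧
    ∀ x ∈ Ω, kobDist Ω x₀ x ≤ C + α * Real.log (1 / bdryDist Ω x)

end Kobayashi

end

namespace Kobayashi

open ComplexConjugate

/-! The Goldilocks conditions force nearly length-minimizing curves between points at Euclidean
distance at least `c` to meet a fixed region `δ_Ω ≥ ρ`. Parametrize a chain of discs by Poincaré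
length: its Euclidean speed at a point is at most `M_Ω(δ_Ω)`. If the curve stays in `δ_Ω < ρ`,
condition (2) makes `δ_Ω` decay exponentially on both sides of a near-maximum, and condition (1)
makes the total Euclidean displacement small with `ρ`, so the endpoints are close. Hence points `c`
apart have bounded Gromov product (`IsGoldilocks.exists_add_le`).

The rest is Karlsson's argument. If `n` is a record time of `K(fⁿ(o), o)` and `m ≤ n`, then
`K(fⁿ(o), fᵐ(o)) ≤ K(fⁿ⁻ᵐ(o), o) ≤ K(fⁿ(o), o)`, so the Gromov product of the two iterates is at
least `K(fᵐ(o), o) / 2`. For large `m` this puts them close together, and the orbit is Cauchy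
(`IsGoldilocks.cauchySeq_iterate`). Another orbit stays at bounded Kobayashi distance from it, hence
has the same limit, which condition (2) places on the boundary. -/

/-! ### Möbius automorphisms and the Poincaré distance -/

theorem one_add_conj_mul_ne_zero {a z : ℂ} (ha : a ∈ disc) (hz : z ∈ disc) :
    1 + conj a * z ≠ 0 := by
  intro h
  have h1 : ‖conj a * z‖ = 1 := by
    rw [eq_neg_of_add_eq_zero_right h]; simp
  rw [disc, mem_ball_zero_iff] at ha hz
  rw [norm_mul, RCLike.norm_conj] at h1
  nlinarith [norm_nonneg a, norm_nonneg z]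

/-- The Möbius automorphism of the disc that maps `0` to `a`. -/
noncomputable def moebius (a z : ℂ) : ℂ := (z + a) / (1 + conj a * z)

theorem moebius_zero (a : ℂ) : moebius a 0 = a := by simp [moebius]

theorem neg_mem_disc {a : ℂ} (ha : a ∈ disc) : -a ∈ disc := by
  simpa [disc] using ha

theorem moebius_mem_disc {a z : ℂ} (ha : a ∈ disc) (hz : z ∈ disc) : moebius a z ∈ disc := by
  have h0 := one_add_conj_mul_ne_zero ha hz
  rw [disc, mem_ball_zero_iff] at *
  rw [moebius, norm_div, div_lt_one (norm_pos_iff.2 h0)]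
  refine lt_of_pow_lt_pow_left₀ 2 (norm_nonneg _) ?_
  have h1 : ‖a‖ ^ 2 < 1 := by nlinarith [norm_nonneg a]
  have h2 : ‖z‖ ^ 2 < 1 := by nlinarith [norm_nonneg z]
  rw [← Complex.normSq_eq_norm_sq, Complex.normSq_apply] at *
  rw [← Complex.normSq_eq_norm_sq, Complex.normSq_apply] at *
  simp only [Complex.add_re, Complex.add_im, Complex.mul_re, Complex.mul_im, Complex.conj_re,
    Complex.conj_im, Complex.one_re, Complex.one_im]
  nlinarith [mul_pos (sub_pos.2 h1) (sub_pos.2 h2)]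

theorem moebius_neg_moebius {a z : ℂ} (ha : a ∈ disc) (hz : z ∈ disc) :
    moebius (-a) (moebius a z) = z := by
  have h0 := one_add_conj_mul_ne_zero ha hz
  have h1 := one_add_conj_mul_ne_zero (neg_mem_disc ha) (moebius_mem_disc ha hz)
  have h2 := one_add_conj_mul_ne_zero (neg_mem_disc ha) ha
  rw [moebius, div_eq_iff h1, moebius, map_neg]
  rw [mul_comm] at h0
  field_simp
  ring

theorem moebius_moebius_neg {a z : ℂ} (ha : a ∈ disc) (hz : z ∈ disc) :
    moebius a (moebius (-a) z) = z := by
  simpa using moebius_neg_moebius (neg_mem_disc ha) hz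

theorem hasDerivAt_moebius_zero (a : ℂ) : HasDerivAt (moebius a) (1 - conj a * a) 0 := by
  have h1 : HasDerivAt (fun z : ℂ => z + a) 1 0 := (hasDerivAt_id _).add_const a
  have h2 : HasDerivAt (fun z : ℂ => 1 + conj a * z) (conj a) 0 := by
    simpa using ((hasDerivAt_id (0 : ℂ)).const_mul (conj a)).const_add 1
  convert! h1.div h2 (by simp) using 1
  simp; ring

theorem differentiableOn_moebius {a : ℂ} (ha : a ∈ disc) :
    DifferentiableOn ℂ (moebius a) disc := by
  unfold moebius
  exact DifferentiableOn.div (by fun_prop) (by fun_prop)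
    fun z hz => one_add_conj_mul_ne_zero ha hz

theorem poincareDist_eq (z w : ℂ) : poincareDist z w = Real.artanh ‖moebius (-z) w‖ := by
  rw [poincareDist, moebius, norm_div, norm_div, norm_sub_rev]
  simp [sub_eq_add_neg]

theorem poincareDist_moebius {a z : ℂ} (ha : a ∈ disc) (hz : z ∈ disc) :
    poincareDist a (moebius a z) = Real.artanh ‖z‖ := by
  rw [poincareDist_eq, moebius_neg_moebius ha hz]

/-! ### Holomorphic discs and normalized chains -/

variable {d : ℕ} {Ω : Set (Cn d)}

theorem IsHolDisc.comp {φ : ℂ → Cn d} (hφ : IsHolDisc Ω φ) {A : ℂ → ℂ}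
    (hA : DifferentiableOn ℂ A disc) (hm : MapsTo A disc disc) : IsHolDisc Ω (φ ∘ A) :=
  ⟨hφ.differentiableOn.comp hA hm, hφ.mapsTo.comp hm⟩

theorem IsHolDisc.comp_moebius {φ : ℂ → Cn d} (hφ : IsHolDisc Ω φ) {a : ℂ} (ha : a ∈ disc) :
    IsHolDisc Ω (φ ∘ moebius a) :=
  hφ.comp (differentiableOn_moebius ha) fun _ hz => moebius_mem_disc ha hz

theorem zero_mem_disc : (0 : ℂ) ∈ disc := by simp [disc]

theorem tanh_mem_disc (t : ℝ) : ((Real.tanh t : ℝ) : ℂ) ∈ disc := by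
  rw [disc, mem_ball_zero_iff, Complex.norm_real]
  exact Real.abs_tanh_lt_one t

theorem tanh_nonneg {t : ℝ} (ht : 0 ≤ t) : 0 ≤ Real.tanh t := by
  rw [Real.tanh_eq_sinh_div_cosh]
  exact div_nonneg (Real.sinh_nonneg_iff.2 ht) (Real.cosh_pos t).le

theorem artanh_norm_tanh {t : ℝ} (ht : 0 ≤ t) : Real.artanh ‖((Real.tanh t : ℝ) : ℂ)‖ = t := by
  rw [Complex.norm_real, Real.norm_of_nonneg (tanh_nonneg ht), Real.artanh_tanh]

theorem poincareDist_tanh {s t : ℝ} (hst : s ≤ t) :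
    poincareDist (Real.tanh s : ℝ) (Real.tanh t : ℝ) = t - s := by
  rw [poincareDist_eq, moebius]
  have : (((Real.tanh t : ℝ) : ℂ) + -((Real.tanh s : ℝ) : ℂ)) /
      (1 + conj (-((Real.tanh s : ℝ) : ℂ)) * ((Real.tanh t : ℝ) : ℂ)) =
      ((Real.tanh (t - s) : ℝ) : ℂ) := by
    rw [map_neg, Complex.conj_ofReal]
    norm_cast
    have hs := (Real.cosh_pos s).ne'
    have ht := (Real.cosh_pos t).ne'
    have h := (Real.cosh_pos (t - s)).ne'
    rw [Real.cosh_sub] at h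
    simp only [Real.tanh_eq_sinh_div_cosh, Real.sinh_sub, Real.cosh_sub]
    rw [div_eq_div_iff _ h]
    · field_simp
      ring
    · intro h'
      apply h
      field_simp at h'
      linarith
  rw [this, artanh_norm_tanh (sub_nonneg.2 hst)]

/-- `ChainLength Ω x y L` says that some chain of holomorphic discs in `Ω`, normalized to be
traversed along a radius from the centre, joins `x` to `y` and has Poincaré length `L`. -/
inductive ChainLength (Ω : Set (Cn d)) : Cn d → Cn d → ℝ → Prop
  | refl {x : Cn d} (hx : x ∈ Ω) : ChainLength Ω x x 0
  | cons {φ : ℂ → Cn d} {y : Cn d} {t L : ℝ} (hφ : IsHolDisc Ω φ) (ht : 0 ≤ t)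
      (h : ChainLength Ω (φ (Real.tanh t : ℝ)) y L) : ChainLength Ω (φ 0) y (t + L)

namespace ChainLength

variable {x y z : Cn d} {L L' : ℝ}

theorem nonneg (h : ChainLength Ω x y L) : 0 ≤ L := by
  induction h with
  | refl => exact le_rfl
  | cons _ ht _ ih => exact add_nonneg ht ih

theorem left_mem (h : ChainLength Ω x y L) : x ∈ Ω := by
  cases h with
  | refl hx => exact hx
  | cons hφ _ _ => exact hφ.mapsTo zero_mem_disc

theorem trans (h : ChainLength Ω x y L) (h' : ChainLength Ω y z L') :
    ChainLength Ω x z (L + L') := by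
  induction h with
  | refl => simpa using h'
  | cons hφ ht _ ih => rw [add_assoc]; exact cons hφ ht (ih h')

/-- A Möbius map moves `ζ` to the centre and a rotation then puts the image of `w` on the positive
radius, which is the form required by `cons`. -/
theorem disc_cons {φ : ℂ → Cn d} (hφ : IsHolDisc Ω φ) {ζ w : ℂ} (hζ : ζ ∈ disc) (hw : w ∈ disc)
    (h : ChainLength Ω (φ w) y L) : ChainLength Ω (φ ζ) y (poincareDist ζ w + L) := by
  set u := moebius (-ζ) w with hu
  have hum : u ∈ disc := moebius_mem_disc (neg_mem_disc hζ) hw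
  set e : ℂ := Complex.exp (Complex.arg u * Complex.I) with he
  have hen : ‖e‖ = 1 := Complex.norm_exp_ofReal_mul_I _
  have hue : e * (‖u‖ : ℝ) = u := by rw [mul_comm]; exact Complex.norm_mul_exp_arg_mul_I u
  have hψ : IsHolDisc Ω ((φ ∘ moebius ζ) ∘ fun s => e * s) :=
    (hφ.comp_moebius hζ).comp (by fun_prop) fun s hs => by simpa [disc, hen] using hs
  have hlt : ‖u‖ < 1 := by simpa [disc] using hum
  have key := cons (y := y) (t := Real.artanh ‖u‖) (L := L) hψ
    (Real.artanh_nonneg (norm_nonneg u)) ?_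
  · simpa [moebius_zero, poincareDist_eq] using key
  · rw [Real.tanh_artanh ⟨by linarith [norm_nonneg u], hlt⟩]
    simp only [Function.comp]
    rwa [hue, hu, moebius_moebius_neg hζ hw]

theorem of_disc {φ : ℂ → Cn d} (hφ : IsHolDisc Ω φ) {ζ w : ℂ} (hζ : ζ ∈ disc) (hw : w ∈ disc) :
    ChainLength Ω (φ ζ) (φ w) (poincareDist ζ w) := by
  simpa using disc_cons hφ hζ hw (refl (hφ.mapsTo hw))

theorem symm (h : ChainLength Ω x y L) : ChainLength Ω y x L := by
  induction h with
  | refl hx => exact refl hx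
  | @cons φ y t L hφ ht h ih =>
    rw [add_comm]
    refine ih.trans ?_
    have := of_disc hφ (tanh_mem_disc t) zero_mem_disc
    have e : poincareDist (Real.tanh t : ℝ) 0 = t := by
      rw [poincareDist]
      simpa using artanh_norm_tanh ht
    rwa [e] at this

/-- Consecutive discs of an analytic chain share the parameter at their junction. Prescribing the
initial parameter `u` lets the induction recentre the remaining chain at the endpoint of the first
disc. -/
theorem exists_isAnalyticChain (h : ChainLength Ω x y L) {u : ℂ} (hu : u ∈ disc) :
    ∃ (n : ℕ) (φ : ℕ → ℂ → Cn d) (ζ : ℕ → ℂ), IsAnalyticChain Ω x y n φ ζ ∧ ζ 0 = u ∧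
      L = ∑ i ∈ Finset.range n, poincareDist (ζ i) (ζ (i + 1)) := by
  induction h generalizing u with
  | @refl x hx =>
    -- An analytic chain has at least one disc, so the empty chain becomes one constant disc.
    refine ⟨1, fun _ _ => x, fun _ => u, ⟨le_rfl, fun _ _ _ => ⟨?_, fun _ _ => hx⟩,
      fun _ _ => hu, rfl, rfl, fun _ _ _ => rfl⟩, rfl, ?_⟩
    · exact differentiableOn_const _
    · simp [poincareDist]
  | @cons φ y t L hφ ht h ih =>
    have hw := moebius_mem_disc hu (tanh_mem_disc t)
    obtain ⟨n, φs, ζs, hc, h0, hL⟩ := ih hw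
    refine ⟨n + 1, fun i => if i ≤ 1 then φ ∘ moebius (-u) else φs (i - 1),
      fun i => if i = 0 then u else ζs (i - 1), ⟨by omega, ?_, ?_, ?_, ?_, ?_⟩, rfl, ?_⟩
    · intro i hi hin
      split_ifs with h1
      · exact hφ.comp_moebius (neg_mem_disc hu)
      · exact hc.isHolDisc _ (by omega) (by omega)
    · intro i hi
      split_ifs with h1
      · exact hu
      · exact hc.mem_disc _ (by omega)
    · simp [moebius]
    · have := hc.one_le
      simp only [show ¬ n + 1 ≤ 1 by omega, if_false, Nat.add_sub_cancel, Nat.succ_ne_zero]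
      exact hc.finish
    · intro i hi hin
      obtain rfl | hi' := hi.eq_or_lt
      · have := hc.start
        simp only [le_refl, if_true, one_ne_zero, if_false, Nat.sub_self, h0, Function.comp,
          moebius_neg_moebius hu (tanh_mem_disc t)]
        rw [← this, h0]
        simp
      · have := hc.link (i - 1) (by omega) (by omega)
        rw [show i - 1 + 1 = i by omega] at this
        simp only [show ¬ i ≤ 1 by omega, show ¬ i + 1 ≤ 1 by omega, show i ≠ 0 by omega,
          if_false, Nat.add_sub_cancel]
        exact this
    · rw [Finset.sum_range_succ', hL]
      simp only [Nat.succ_ne_zero, if_false, Nat.add_sub_cancel, if_true, h0, zero_add]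
      rw [poincareDist_moebius hu (tanh_mem_disc t), artanh_norm_tanh ht, add_comm]

end ChainLength

theorem IsAnalyticChain.chainLength {x y : Cn d} {n : ℕ} {φ : ℕ → ℂ → Cn d} {ζ : ℕ → ℂ}
    (h : IsAnalyticChain Ω x y n φ ζ) :
    ChainLength Ω x y (∑ i ∈ Finset.range n, poincareDist (ζ i) (ζ (i + 1))) := by
  obtain ⟨n, rfl⟩ : ∃ m, n = m + 1 := ⟨n - 1, by have := h.one_le; omega⟩
  induction n generalizing x φ ζ with
  | zero =>
    have := ChainLength.of_disc (h.isHolDisc 1 le_rfl (by simp)) (h.mem_disc 0 (by simp))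
      (h.mem_disc 1 (by simp))
    have hf := h.finish
    simp only [zero_add] at hf
    rw [h.start, hf] at this
    simpa using this
  | succ n ih =>
    rw [Finset.sum_range_succ', add_comm, ← h.start]
    refine ChainLength.disc_cons (h.isHolDisc 1 le_rfl (by omega)) (h.mem_disc 0 (by omega))
      (h.mem_disc 1 (by omega)) ?_
    refine ih (φ := fun i => φ (i + 1)) (ζ := fun i => ζ (i + 1))
      ⟨by omega, fun i h1 h2 => h.isHolDisc _ (by omega) (by omega),
        fun i h1 => h.mem_disc _ (by omega), (h.link 1 le_rfl (by omega)).symm, h.finish,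
        fun i h1 h2 => h.link _ (by omega) (by omega)⟩

/-! ### The Kobayashi pseudo-distance -/

theorem kobDist_eq_sInf_chainLength (Ω : Set (Cn d)) (x y : Cn d) :
    kobDist Ω x y = sInf {L | ChainLength Ω x y L} := by
  rw [kobDist]
  congr 1
  ext L
  constructor
  · rintro ⟨n, φ, ζ, h, rfl⟩
    exact h.chainLength
  · intro h
    obtain ⟨n, φ, ζ, hc, -, hL⟩ := h.exists_isAnalyticChain zero_mem_disc
    exact ⟨n, φ, ζ, hc, hL⟩

theorem bddBelow_chainLength (x y : Cn d) : BddBelow {L | ChainLength Ω x y L} :=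
  ⟨0, fun _ h => ChainLength.nonneg h⟩

theorem kobDist_le_of_chainLength {x y : Cn d} {L : ℝ} (h : ChainLength Ω x y L) :
    kobDist Ω x y ≤ L := by
  rw [kobDist_eq_sInf_chainLength]
  exact csInf_le (bddBelow_chainLength x y) h

theorem kobDist_nonneg (x y : Cn d) : 0 ≤ kobDist Ω x y := by
  rw [kobDist_eq_sInf_chainLength]
  exact Real.sInf_nonneg fun _ h => ChainLength.nonneg h

theorem kobDist_comm (x y : Cn d) : kobDist Ω x y = kobDist Ω y x := by
  simp only [kobDist_eq_sInf_chainLength]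
  congr 1
  ext L
  exact ⟨ChainLength.symm, ChainLength.symm⟩

theorem isHolDisc_of_ball_subset {x v : Cn d} {r : ℝ} (hr : 0 < r) (hb : Metric.ball x r ⊆ Ω)
    (hv : ‖v‖ ≤ r) : IsHolDisc Ω fun z : ℂ => x + z • v := by
  refine ⟨by fun_prop, fun z hz => hb ?_⟩
  rw [disc, mem_ball_zero_iff] at hz
  rw [mem_ball_iff_norm, add_sub_cancel_left, norm_smul]
  nlinarith [norm_nonneg z]

/-- Without this, an infimum over an empty set would be `0` and the triangle inequality could fail.
Nearby points lie on an affine disc; connectedness does the rest. -/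
theorem exists_chainLength (hΩ : IsOpen Ω) (hc : IsPreconnected Ω) {x y : Cn d} (hx : x ∈ Ω)
    (hy : y ∈ Ω) : ∃ L, ChainLength Ω x y L := by
  refine hc.induction₂ (fun x y => ∃ L, ChainLength Ω x y L) (fun z hz => ?_)
    (fun x y z _ _ _ => ?_) (fun x y _ _ => ?_) hx hy
  · obtain ⟨r, hr, hb⟩ := Metric.isOpen_iff.1 hΩ z hz
    filter_upwards [mem_nhdsWithin_of_mem_nhds (Metric.ball_mem_nhds z (half_pos hr))] with w hw
    -- The factor `2` makes the disc reach `w` at the parameter `1 / 2`.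
    have hv : ‖(2 : ℂ) • (w - z)‖ ≤ r := by
      rw [mem_ball_iff_norm] at hw
      rw [norm_smul, Complex.norm_ofNat]
      linarith
    have := ChainLength.of_disc (isHolDisc_of_ball_subset hr hb hv) zero_mem_disc
      (w := (1 / 2 : ℂ)) (by simp [disc]; norm_num)
    refine ⟨poincareDist 0 (1 / 2), ?_⟩
    simpa [smul_smul] using this
  · rintro ⟨L, h⟩ ⟨L', h'⟩
    exact ⟨_, h.trans h'⟩
  · rintro ⟨L, h⟩
    exact ⟨_, h.symm⟩

theorem exists_chainLength_lt (hΩ : IsOpen Ω) (hc : IsPreconnected Ω) {x y : Cn d} (hx : x ∈ Ω)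
    (hy : y ∈ Ω) {κ : ℝ} (hκ : 0 < κ) : ∃ L, ChainLength Ω x y L ∧ L < kobDist Ω x y + κ := by
  rw [kobDist_eq_sInf_chainLength]
  exact Real.lt_sInf_add_pos (exists_chainLength hΩ hc hx hy) hκ

theorem kobDist_triangle (hΩ : IsOpen Ω) (hc : IsPreconnected Ω) {x y z : Cn d} (hx : x ∈ Ω)
    (hy : y ∈ Ω) (hz : z ∈ Ω) : kobDist Ω x z ≤ kobDist Ω x y + kobDist Ω y z := by
  refine le_of_forall_pos_le_add fun ε hε => ?_
  obtain ⟨L, h, hL⟩ := exists_chainLength_lt hΩ hc hx hy (half_pos hε)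
  obtain ⟨L', h', hL'⟩ := exists_chainLength_lt hΩ hc hy hz (half_pos hε)
  linarith [kobDist_le_of_chainLength (h.trans h')]

/-! ### The Kobayashi–Royden metric and the growth function -/

theorem exists_norm_deriv_le (hb : Bornology.IsBounded Ω) :
    ∃ R : ℝ, 0 < R ∧ ∀ φ : ℂ → Cn d, IsHolDisc Ω φ → ‖deriv φ 0‖ ≤ R := by
  obtain ⟨R, hR, h⟩ := hb.exists_pos_norm_le
  refine ⟨2 * R, by positivity, fun φ hφ => ?_⟩
  have := Complex.norm_deriv_le_div_of_mapsTo_ball (c := (0 : ℂ)) (R₁ := 1) (R₂ := 2 * R)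
    hφ.differentiableOn (fun z hz => ?_) one_pos
  · simpa using this
  · rw [mem_closedBall_iff_norm]
    linarith [norm_sub_le (φ z) (φ 0), h _ (hφ.mapsTo hz), h _ (hφ.mapsTo zero_mem_disc)]

theorem kobMetric_nonneg (x v : Cn d) : 0 ≤ kobMetric Ω x v :=
  Real.sInf_nonneg fun _ ⟨_, _, _, _, _, h⟩ => h ▸ norm_nonneg _

theorem kobMetric_le {φ : ℂ → Cn d} (hφ : IsHolDisc Ω φ) {ξ : ℂ} {v : Cn d}
    (h : ξ • deriv φ 0 = v) : kobMetric Ω (φ 0) v ≤ ‖ξ‖ :=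
  csInf_le ⟨0, fun _ ⟨_, _, _, _, _, h⟩ => h ▸ norm_nonneg _⟩ ⟨φ, ξ, hφ, rfl, h, rfl⟩

/-- On a bounded domain the Kobayashi–Royden metric dominates a multiple of the norm at every
vector that is tangent to a disc. -/
theorem exists_le_kobMetric (hb : Bornology.IsBounded Ω) :
    ∃ R : ℝ, 0 < R ∧ ∀ x v : Cn d, ‖v‖ = 1 →
      (∃ (φ : ℂ → Cn d) (ξ : ℂ), IsHolDisc Ω φ ∧ φ 0 = x ∧ ξ • deriv φ 0 = v) →
      1 / R ≤ kobMetric Ω x v := by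
  obtain ⟨R, hR, h⟩ := exists_norm_deriv_le hb
  refine ⟨R, hR, fun x v hv ⟨φ, ξ, h1, h2, h3⟩ => ?_⟩
  refine le_csInf ⟨‖ξ‖, φ, ξ, h1, h2, h3, rfl⟩ ?_
  rintro t ⟨ψ, η, hψ, -, hη, rfl⟩
  rw [div_le_iff₀ hR, ← hv, ← hη, norm_smul]
  exact mul_le_mul_of_nonneg_left (h ψ hψ) (norm_nonneg _)

theorem bddAbove_growth (hb : Bornology.IsBounded Ω) (r : ℝ) :
    BddAbove {t : ℝ | ∃ x v : Cn d, x ∈ Ω ∧ bdryDist Ω x ≤ r ∧ ‖v‖ = 1 ∧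
      t = 1 / kobMetric Ω x v} := by
  obtain ⟨R, hR, h⟩ := exists_le_kobMetric hb
  refine ⟨R, ?_⟩
  rintro t ⟨x, v, -, -, hv, rfl⟩
  by_cases hne : ∃ (φ : ℂ → Cn d) (ξ : ℂ), IsHolDisc Ω φ ∧ φ 0 = x ∧ ξ • deriv φ 0 = v
  · exact (one_div_le hR (lt_of_lt_of_le (by positivity) (h x v hv hne))).1 (h x v hv hne)
  -- With no disc tangent to `v`, the infimum is that of the empty set, and `1 / 0 = 0`.
  · have : {t : ℝ | ∃ (φ : ℂ → Cn d) (ξ : ℂ), IsHolDisc Ω φ ∧ φ 0 = x ∧ ξ • deriv φ 0 = v ∧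
        t = ‖ξ‖} = ∅ := by
      refine eq_empty_of_forall_notMem ?_
      rintro t ⟨φ, ξ, h1, h2, h3, -⟩
      exact hne ⟨φ, ξ, h1, h2, h3⟩
    rw [kobMetric, this, Real.sInf_empty, div_zero]
    exact hR.le

theorem growth_nonneg (r : ℝ) : 0 ≤ growth Ω r :=
  Real.sSup_nonneg fun _ ⟨_, _, _, _, _, h⟩ => h ▸ div_nonneg zero_le_one (kobMetric_nonneg _ _)

theorem growth_mono (hb : Bornology.IsBounded Ω) : Monotone (growth Ω) := by
  intro r s hrs
  refine Real.sSup_le ?_ (growth_nonneg s)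
  rintro t ⟨x, v, hx, hr, hv, rfl⟩
  exact le_csSup (bddAbove_growth hb s) ⟨x, v, hx, hr.trans hrs, hv, rfl⟩

theorem IsHolDisc.norm_deriv_zero_le (hb : Bornology.IsBounded Ω) {φ : ℂ → Cn d}
    (hφ : IsHolDisc Ω φ) {r : ℝ} (hr : bdryDist Ω (φ 0) ≤ r) : ‖deriv φ 0‖ ≤ growth Ω r := by
  rcases eq_or_ne (deriv φ 0) 0 with h0 | h0
  · simpa [h0] using growth_nonneg r
  obtain ⟨R, hR, h⟩ := exists_le_kobMetric hb
  have hn : 0 < ‖deriv φ 0‖ := norm_pos_iff.2 h0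
  set ξ : ℂ := ((‖deriv φ 0‖⁻¹ : ℝ) : ℂ) with hξ
  have hξn : ‖ξ‖ = ‖deriv φ 0‖⁻¹ := by
    rw [hξ, Complex.norm_real, Real.norm_of_nonneg (inv_nonneg.2 hn.le)]
  have hv : ‖ξ • deriv φ 0‖ = 1 := by rw [norm_smul, hξn, inv_mul_cancel₀ hn.ne']
  have h1 := h (φ 0) _ hv ⟨φ, ξ, hφ, rfl, rfl⟩
  have h2 := kobMetric_le hφ (ξ := ξ) rfl
  have hpos : 0 < kobMetric Ω (φ 0) (ξ • deriv φ 0) := lt_of_lt_of_le (by positivity) h1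
  calc ‖deriv φ 0‖ ≤ 1 / kobMetric Ω (φ 0) (ξ • deriv φ 0) := by
        rw [le_div_iff₀ hpos]
        calc _ ≤ ‖deriv φ 0‖ * ‖ξ‖ := by gcongr
          _ = 1 := by rw [hξn, mul_inv_cancel₀ hn.ne']
    _ ≤ growth Ω r := le_csSup (bddAbove_growth hb r) ⟨_, _, hφ.mapsTo zero_mem_disc, hr, hv, rfl⟩

theorem IsHolDisc.hasDerivAt {φ : ℂ → Cn d} (hφ : IsHolDisc Ω φ) {ζ : ℂ} (hζ : ζ ∈ disc) :
    HasDerivAt φ (deriv φ ζ) ζ :=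
  (hφ.differentiableOn.differentiableAt (Metric.isOpen_ball.mem_nhds hζ)).hasDerivAt

/-- The vector is the velocity of `u ↦ φ (tanh u)` at `t`, and also the derivative at the centre of
`φ` precomposed with a Möbius map. -/
theorem IsHolDisc.norm_deriv_tanh_le (hb : Bornology.IsBounded Ω) {φ : ℂ → Cn d}
    (hφ : IsHolDisc Ω φ) {t r : ℝ} (hr : bdryDist Ω (φ (Real.tanh t : ℝ)) ≤ r) :
    ‖((1 - Real.tanh t ^ 2 : ℝ) : ℂ) • deriv φ (Real.tanh t : ℝ)‖ ≤ growth Ω r := by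
  have ht := tanh_mem_disc t
  have h1 : HasDerivAt (φ ∘ moebius (Real.tanh t : ℝ))
      (((1 - Real.tanh t ^ 2 : ℝ) : ℂ) • deriv φ (Real.tanh t : ℝ)) 0 := by
    have := HasDerivAt.scomp (0 : ℂ) (g₁ := φ) (h := moebius (Real.tanh t : ℝ))
      (by rw [moebius_zero]; exact hφ.hasDerivAt ht) (hasDerivAt_moebius_zero _)
    convert! this using 2
    rw [Complex.conj_ofReal]; push_cast; ring
  rw [← h1.deriv]
  exact (hφ.comp_moebius ht).norm_deriv_zero_le hb (by simpa [moebius_zero] using hr)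

theorem hasDerivAt_real_tanh (t : ℝ) : HasDerivAt Real.tanh (1 - Real.tanh t ^ 2) t := by
  have h := (Real.hasDerivAt_sinh t).div (Real.hasDerivAt_cosh t) (Real.cosh_pos t).ne'
  have hc := (Real.cosh_pos t).ne'
  have e : Real.tanh = Real.sinh / Real.cosh := by
    ext s; simp [Real.tanh_eq_sinh_div_cosh]
  rw [← e] at h
  convert! h using 1
  rw [Real.tanh_eq_sinh_div_cosh]
  field_simp

theorem IsHolDisc.norm_sub_le (hb : Bornology.IsBounded Ω) {φ : ℂ → Cn d}
    (hφ : IsHolDisc Ω φ) {s t r : ℝ} (hst : s ≤ t)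
    (hr : ∀ u ∈ Icc s t, bdryDist Ω (φ (Real.tanh u : ℝ)) ≤ r) :
    ‖φ (Real.tanh t : ℝ) - φ (Real.tanh s : ℝ)‖ ≤ growth Ω r * (t - s) := by
  refine norm_image_sub_le_of_norm_deriv_le_segment'
    (f := fun u : ℝ => φ (Real.tanh u : ℝ))
    (f' := fun u => ((1 - Real.tanh u ^ 2 : ℝ) : ℂ) • deriv φ (Real.tanh u : ℝ))
    (fun u _ => ?_) (fun u hu => ?_) t (right_mem_Icc.2 hst)
  · refine HasDerivAt.hasDerivWithinAt ?_
    exact HasDerivAt.scomp u (g₁ := φ) (h := fun u : ℝ => ((Real.tanh u : ℝ) : ℂ))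
      (hφ.hasDerivAt (tanh_mem_disc u)) (hasDerivAt_real_tanh u).ofReal_comp
  · exact hφ.norm_deriv_tanh_le hb (hr u (Ico_subset_Icc_self hu))

/-! ### Curves following chains -/

/-- A curve in `Ω`, parametrized by the Poincaré length of a chain of discs that it follows. -/
structure IsChainCurve (Ω : Set (Cn d)) (L : ℝ) (σ : ℝ → Cn d) : Prop where
  chainLength : ∀ s t, 0 ≤ s → s ≤ t → t ≤ L → ChainLength Ω (σ s) (σ t) (t - s)
  norm_sub_le : ∀ s t r, 0 ≤ s → s ≤ t → t ≤ L → (∀ u ∈ Icc s t, bdryDist Ω (σ u) ≤ r) →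
    ‖σ t - σ s‖ ≤ growth Ω r * (t - s)

theorem ChainLength.exists_isChainCurve (hb : Bornology.IsBounded Ω) {x y : Cn d} {L : ℝ}
    (h : ChainLength Ω x y L) : ∃ σ : ℝ → Cn d, IsChainCurve Ω L σ ∧ σ 0 = x ∧ σ L = y := by
  induction h with
  | @refl x hx =>
    refine ⟨fun _ => x, ⟨fun s t h1 h2 h3 => ?_, fun s t r h1 h2 h3 _ => ?_⟩, rfl, rfl⟩
    · obtain rfl : t = s := by linarith
      simpa using ChainLength.refl hx
    · simpa using mul_nonneg (growth_nonneg r) (sub_nonneg.2 h2)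
  | @cons φ y a L hφ ha h ih =>
    obtain ⟨τ, ⟨h1, h2⟩, h3, h4⟩ := ih
    have hL := h.nonneg
    set σ : ℝ → Cn d := fun t => if t ≤ a then φ (Real.tanh t : ℝ) else τ (t - a) with hσ
    have left : ∀ t ≤ a, σ t = φ (Real.tanh t : ℝ) := fun t ht => if_pos ht
    have right : ∀ t, a ≤ t → σ t = τ (t - a) := by
      intro t ht
      rcases ht.eq_or_lt with rfl | ht
      · rw [left _ le_rfl, sub_self, h3]
      · exact if_neg (not_le.2 ht)
    have cl : ∀ s t, s ≤ t → t ≤ a → ChainLength Ω (σ s) (σ t) (t - s) := by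
      intro s t hst hta
      rw [left s (hst.trans hta), left t hta, ← poincareDist_tanh hst]
      exact ChainLength.of_disc hφ (tanh_mem_disc s) (tanh_mem_disc t)
    have cr : ∀ s t, a ≤ s → s ≤ t → t ≤ a + L → ChainLength Ω (σ s) (σ t) (t - s) := by
      intro s t has hst htL
      rw [right s has, right t (has.trans hst)]
      simpa using h1 (s - a) (t - a) (by linarith) (by linarith) (by linarith)
    have nl : ∀ s t r, s ≤ t → t ≤ a → (∀ u ∈ Icc s t, bdryDist Ω (σ u) ≤ r) →
        ‖σ t - σ s‖ ≤ growth Ω r * (t - s) := by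
      intro s t r hst hta hr
      rw [left s (hst.trans hta), left t hta]
      refine hφ.norm_sub_le hb hst fun u hu => ?_
      rw [← left u (hu.2.trans hta)]
      exact hr u hu
    have nr : ∀ s t r, a ≤ s → s ≤ t → t ≤ a + L → (∀ u ∈ Icc s t, bdryDist Ω (σ u) ≤ r) →
        ‖σ t - σ s‖ ≤ growth Ω r * (t - s) := by
      intro s t r has hst htL hr
      rw [right s has, right t (has.trans hst)]
      have := h2 (s - a) (t - a) r (by linarith) (by linarith) (by linarith) fun u hu => ?_
      · simpa using this
      · have := hr (u + a) ⟨by linarith [hu.1], by linarith [hu.2]⟩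
        rwa [right _ (by linarith [hu.1]), add_sub_cancel_right] at this
    refine ⟨σ, ⟨fun s t hs hst ht => ?_, fun s t r hs hst ht hr => ?_⟩, ?_, ?_⟩
    · rcases le_total t a with hta | hta
      · exact cl s t hst hta
      rcases le_total a s with has | has
      · exact cr s t has hst ht
      have := (cl s a has le_rfl).trans (cr a t le_rfl hta ht)
      rwa [show a - s + (t - a) = t - s by ring] at this
    · rcases le_total t a with hta | hta
      · exact nl s t r hst hta hr
      rcases le_total a s with has | has
      · exact nr s t r has hst ht hr
      have e1 := nl s a r has le_rfl fun u hu => hr u ⟨hu.1, hu.2.trans hta⟩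
      have e2 := nr a t r le_rfl hta ht fun u hu => hr u ⟨has.trans hu.1, hu.2⟩
      have e3 := norm_sub_le_norm_sub_add_norm_sub (σ t) (σ a) (σ s)
      linarith
    · rw [left 0 ha]; simp
    · rw [right _ (by linarith), add_sub_cancel_left, h4]

/-! ### The integral condition as a summability condition -/

/-- With `e k = exp (a - b * k)`, monotonicity bounds the integral of `M_Ω(r) / r` over `(e (k+1), e
k]` below by `(1 - exp (-b)) * M_Ω(e (k+1))`. -/
theorem IsGoldilocks.summable_growth (hΩ : IsGoldilocks Ω) (a : ℝ) {b : ℝ} (hb : 0 < b) :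
    Summable fun k : ℕ => growth Ω (Real.exp (a - b * k)) := by
  obtain ⟨ε, hε, hint⟩ := hΩ.integrable
  set e : ℕ → ℝ := fun k => Real.exp (a - b * k) with he
  have hanti : Antitone e := by
    intro i j hij
    have : (i : ℝ) ≤ j := by exact_mod_cast hij
    exact Real.exp_le_exp.2 (by nlinarith)
  have hlim : Tendsto e atTop (𝓝 0) := by
    refine Real.tendsto_exp_atBot.comp ?_
    refine tendsto_atBot_add_const_left _ a (tendsto_neg_atTop_atBot.comp ?_)
    exact tendsto_natCast_atTop_atTop.const_mul_atTop hb
  obtain ⟨k₁, hk₁⟩ := (hlim.eventually_lt_const hε).exists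
  set s : ℕ → Set ℝ := fun k => Ioc (e (k + 1 + k₁)) (e (k + k₁)) with hs
  have hsub : ⋃ k, s k ⊆ Ioo 0 ε := by
    refine iUnion_subset fun k r hr => ⟨(Real.exp_pos _).trans hr.1, ?_⟩
    exact (hr.2.trans (hanti (Nat.le_add_left _ _))).trans_lt hk₁
  have hdisj : Pairwise (Function.onFun Disjoint s) :=
    Antitone.pairwise_disjoint_on_Ioc_succ (f := fun k => e (k + k₁))
      fun i j hij => hanti (Nat.add_le_add_right hij k₁)
  have hsum := (hasSum_integral_iUnion (fun k => measurableSet_Ioc) hdisj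
    (hint.mono_set hsub)).summable
  rw [← summable_nat_add_iff (k₁ + 1)]
  have hq : 0 < 1 - Real.exp (-b) := by
    have : Real.exp (-b) < 1 := by simpa using hb
    linarith
  refine Summable.of_nonneg_of_le (fun k => growth_nonneg _) (fun k => ?_)
    (hsum.mul_left (1 - Real.exp (-b))⁻¹)
  rw [le_inv_mul_iff₀ hq]
  have hstep : e (k + 1 + k₁) = e (k + k₁) * Real.exp (-b) := by
    simp only [he]
    rw [← Real.exp_add]
    congr 1
    push_cast; ring
  have hpos : 0 < e (k + k₁) := Real.exp_pos _
  have hpos' : 0 < e (k + 1 + k₁) := Real.exp_pos _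
  have key := setIntegral_ge_of_const_le_real (μ := volume) (s := s k)
    (c := 1 / e (k + k₁) * growth Ω (e (k + 1 + k₁))) measurableSet_Ioc
    (by simp [hs]) (f := fun r => 1 / r * growth Ω r) (fun r hr => ?_)
    (hint.mono_set ((subset_iUnion s k).trans hsub))
  · refine le_trans (le_of_eq ?_) key
    rw [hs, Real.volume_real_Ioc_of_le (hanti (by omega))]
    have : k + (k₁ + 1) = k + 1 + k₁ := by ring
    rw [show Real.exp (a - b * ((k + (k₁ + 1) : ℕ) : ℝ)) = e (k + 1 + k₁) by rw [this]]
    have h1 : e (k + k₁) - e (k + 1 + k₁) = e (k + k₁) * (1 - Real.exp (-b)) := by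
      rw [hstep]; ring
    rw [h1]
    field_simp
  · have hr0 : 0 < r := hpos'.trans hr.1
    exact mul_le_mul (one_div_le_one_div_of_le hr0 hr.2) (growth_mono hΩ.isBounded hr.1.le)
      (growth_nonneg _) (by positivity)

/-- A tail of the series is below `c / 2`; `δ` is then small enough for the finitely many earlier
terms to add at most `c / 2`. -/
theorem exists_sum_min_le {g : ℕ → ℝ} (hg : Summable g) (h0 : ∀ k, 0 ≤ g k) {c : ℝ} (hc : 0 < c) :
    ∃ δ : ℝ, 0 < δ ∧ ∀ n, ∑ k ∈ Finset.range n, min δ (g k) ≤ c := by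
  obtain ⟨k₀, hk₀⟩ := ((tendsto_sum_nat_add g).eventually_lt_const (half_pos hc)).exists
  have hδ : 0 < c / (2 * (k₀ + 1)) := by positivity
  refine ⟨c / (2 * (k₀ + 1)), hδ, fun n => ?_⟩
  calc ∑ k ∈ Finset.range n, min (c / (2 * (k₀ + 1))) (g k)
      ≤ ∑ k ∈ Finset.range (k₀ + n), min (c / (2 * (k₀ + 1))) (g k) :=
        Finset.sum_le_sum_of_subset_of_nonneg (Finset.range_mono (Nat.le_add_left _ _))
          fun k _ _ => le_min hδ.le (h0 k)
    _ ≤ ∑ k ∈ Finset.range k₀, c / (2 * (k₀ + 1)) + ∑ k ∈ Finset.range n, g (k + k₀) := by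
        rw [Finset.sum_range_add]
        refine add_le_add (Finset.sum_le_sum fun k _ => min_le_left _ _)
          (Finset.sum_le_sum fun k _ => ?_)
        rw [add_comm k₀ k]
        exact min_le_right _ _
    _ ≤ c / 2 + c / 2 := by
        refine add_le_add ?_ (((summable_nat_add_iff k₀).2 hg).sum_le_tsum _
          (fun k _ => h0 _) |>.trans hk₀.le)
        rw [Finset.sum_const, Finset.card_range, nsmul_eq_mul, ← mul_div_assoc,
          div_le_div_iff₀ (by positivity) two_pos]
        nlinarith
    _ = c := add_halves c

theorem IsGoldilocks.exists_sum_min_growth_le (hΩ : IsGoldilocks Ω) (a : ℝ) {b c : ℝ} (hb : 0 < b)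
    (hc : 0 < c) : ∃ ρ : ℝ, 0 < ρ ∧ ∀ n, ∑ k ∈ Finset.range n,
      min (growth Ω ρ) (growth Ω (Real.exp (a - b * k))) ≤ c := by
  have hs := hΩ.summable_growth a hb
  obtain ⟨δ, hδ, h⟩ := exists_sum_min_le hs (fun k => growth_nonneg _) hc
  obtain ⟨k, hk⟩ := (hs.tendsto_atTop_zero.eventually_le_const hδ).exists
  exact ⟨_, Real.exp_pos _, fun n =>
    (Finset.sum_le_sum fun i _ => min_le_min_right _ hk).trans (h n)⟩

namespace IsChainCurve

variable {L : ℝ} {σ : ℝ → Cn d}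

theorem reverse (h : IsChainCurve Ω L σ) : IsChainCurve Ω L fun t => σ (L - t) := by
  refine ⟨fun s t hs hst ht => ?_, fun s t r hs hst ht hr => ?_⟩
  · have := (h.chainLength (L - t) (L - s) (by linarith) (by linarith) (by linarith)).symm
    rwa [show L - s - (L - t) = t - s by ring] at this
  · have := h.norm_sub_le (L - t) (L - s) r (by linarith) (by linarith) (by linarith) fun u hu => ?_
    · rw [norm_sub_rev]
      rwa [show L - s - (L - t) = t - s by ring] at this
    · simpa using hr (L - u) ⟨by linarith [hu.2], by linarith [hu.1]⟩

/-- Cut `[t₀, L]` into unit steps, the last ones truncated at `L`. Step `k` moves by at most the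
growth at either bound on `δ_Ω`, hence by at most their minimum. -/
theorem dist_le (h : IsChainCurve Ω L σ) {t₀ ρ a b c : ℝ} (hb : 0 ≤ b) (h0 : 0 ≤ t₀) (hL : t₀ ≤ L)
    (hρ : ∀ t ∈ Icc t₀ L, bdryDist Ω (σ t) ≤ ρ)
    (hab : ∀ t ∈ Icc t₀ L, bdryDist Ω (σ t) ≤ Real.exp (a - b * (t - t₀)))
    (hc : ∀ n, ∑ k ∈ Finset.range n, min (growth Ω ρ) (growth Ω (Real.exp (a - b * k))) ≤ c) :
    dist (σ t₀) (σ L) ≤ c := by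
  obtain ⟨n, hn⟩ := exists_nat_ge (L - t₀)
  have key := dist_le_range_sum_of_dist_le (f := fun k : ℕ => σ (min (t₀ + k) L)) n
    (d := fun k => min (growth Ω ρ) (growth Ω (Real.exp (a - b * k)))) fun {k} _ => ?_
  · have e : min (t₀ + (n : ℝ)) L = L := min_eq_right (by linarith)
    simp only [Nat.cast_zero, add_zero, min_eq_left hL, e] at key
    exact key.trans (hc n)
  · rcases le_total L (t₀ + k) with hk | hk
    · have e : min (t₀ + ((k + 1 : ℕ) : ℝ)) L = L := min_eq_right (by push_cast; linarith)
      simp only [min_eq_right hk, e, dist_self]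
      exact le_min (growth_nonneg _) (growth_nonneg _)
    · simp only [min_eq_left hk]
      have hk0 : (0 : ℝ) ≤ k := k.cast_nonneg
      set T := min (t₀ + ((k + 1 : ℕ) : ℝ)) L with hT
      have hT1 : T ≤ L := min_le_right _ _
      have hT2 : T ≤ t₀ + (k + 1) := by rw [hT]; push_cast; exact min_le_left _ _
      have hT3 : t₀ + k ≤ T := le_min (by push_cast; linarith) hk
      have main : ∀ r, (∀ u ∈ Icc (t₀ + k) T, bdryDist Ω (σ u) ≤ r) →
          dist (σ (t₀ + k)) (σ T) ≤ growth Ω r := by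
        intro r hr
        rw [dist_comm, dist_eq_norm]
        refine (h.norm_sub_le _ _ r (by linarith) hT3 hT1 hr).trans ?_
        exact mul_le_of_le_one_right (growth_nonneg r) (by linarith)
      refine le_min (main _ fun u hu => hρ u ⟨by linarith [hu.1], hu.2.trans hT1⟩)
        (main _ fun u hu => (hab u ⟨by linarith [hu.1], hu.2.trans hT1⟩).trans ?_)
      exact Real.exp_le_exp.2 (by nlinarith [hu.1])

end IsChainCurve

/-! ### Bounded Gromov products -/

theorem IsGoldilocks.bdryDist_pos (hΩ : IsGoldilocks Ω) (hf : (frontier Ω).Nonempty) {x : Cn d}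
    (hx : x ∈ Ω) : 0 < bdryDist Ω x := by
  refine (isClosed_frontier.notMem_iff_infDist_pos hf).1 fun h => ?_
  rw [hΩ.isOpen.frontier_eq] at h
  exact h.2 hx

theorem IsGoldilocks.triangle (hΩ : IsGoldilocks Ω) {x y z : Cn d} (hx : x ∈ Ω)
    (hy : y ∈ Ω) (hz : z ∈ Ω) : kobDist Ω x z ≤ kobDist Ω x y + kobDist Ω y z :=
  kobDist_triangle hΩ.isOpen hΩ.isConnected.isPreconnected hx hy hz

/-- Points of a Goldilocks domain at a definite Euclidean distance have bounded Gromov product. -/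
theorem IsGoldilocks.exists_add_le (hΩ : IsGoldilocks Ω) (hf : (frontier Ω).Nonempty) {o : Cn d}
    (ho : o ∈ Ω) {c : ℝ} (hc : 0 < c) : ∃ D : ℝ, ∀ x ∈ Ω, ∀ y ∈ Ω, c ≤ dist x y →
      kobDist Ω x o + kobDist Ω o y ≤ kobDist Ω x y + D := by
  obtain ⟨C, α, -, hα, hK⟩ := hΩ.dist_le o ho
  -- These are the constants of the exponential decay `hexp`. They depend only on `C` and `α`, so
  -- `ρ` and `D` are uniform in `x` and `y`.
  set b : ℝ := 1 / (2 * α) with hb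
  set a : ℝ := (2 * C + α * Real.log 2 + 1) / (2 * α) with ha
  have hbpos : 0 < b := by positivity
  obtain ⟨ρ, hρ, hsum⟩ := hΩ.exists_sum_min_growth_le a hbpos (show 0 < c / 3 by positivity)
  refine ⟨2 * (C + α * Real.log (1 / ρ)) + 1, fun x hx y hy hxy => ?_⟩
  by_contra! hlt
  obtain ⟨L, hL, hLlt⟩ := exists_chainLength_lt hΩ.isOpen hΩ.isConnected.isPreconnected hx hy
    one_pos
  obtain ⟨σ, hσ, h0, h1⟩ := hL.exists_isChainCurve hΩ.isBounded
  have hL0 := hL.nonneg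
  have hleft : ∀ t ∈ Icc 0 L, kobDist Ω x (σ t) ≤ t := fun t ht => by
    simpa [h0] using kobDist_le_of_chainLength (hσ.chainLength 0 t le_rfl ht.1 ht.2)
  have hright : ∀ t ∈ Icc 0 L, kobDist Ω (σ t) y ≤ L - t := fun t ht => by
    simpa [h1] using kobDist_le_of_chainLength (hσ.chainLength t L ht.1 ht.2 le_rfl)
  have hmem : ∀ t ∈ Icc 0 L, σ t ∈ Ω := fun t ht =>
    (hσ.chainLength t t ht.1 le_rfl ht.2).left_mem
  have hpos : ∀ t ∈ Icc 0 L, 0 < bdryDist Ω (σ t) := fun t ht => hΩ.bdryDist_pos hf (hmem t ht)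
  -- A point of the curve with `δ_Ω ≥ ρ` would be within `C + α * log (1 / ρ)` of `o`, and a detour
  -- through it would contradict `hlt`.
  have hltρ : ∀ t ∈ Icc 0 L, bdryDist Ω (σ t) < ρ := by
    intro t ht
    have e1 := hΩ.triangle hx (hmem t ht) ho
    have e2 := hΩ.triangle ho (hmem t ht) hy
    rw [kobDist_comm (σ t) o] at e1
    have e3 := hK _ (hmem t ht)
    have e4 : α * Real.log (1 / ρ) < α * Real.log (1 / bdryDist Ω (σ t)) := by
      linarith [hleft t ht, hright t ht]
    have e5 := lt_of_mul_lt_mul_left e4 hα.le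
    rw [Real.log_lt_log_iff (by positivity) (one_div_pos.2 (hpos t ht))] at e5
    exact (one_div_lt_one_div hρ (hpos t ht)).1 e5
  -- Half of the supremum suffices, so it need not be attained; the factor `2` accounts for `log 2`
  -- in `a`.
  obtain ⟨t₀, ht₀, hmax⟩ : ∃ t₀ ∈ Icc 0 L, ∀ t ∈ Icc 0 L,
      bdryDist Ω (σ t) ≤ 2 * bdryDist Ω (σ t₀) := by
    set S := (fun t => bdryDist Ω (σ t)) '' Icc 0 L with hS
    have hbdd : BddAbove S := ⟨ρ, by rintro _ ⟨t, ht, rfl⟩; exact (hltρ t ht).le⟩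
    have hne : S.Nonempty := ⟨_, 0, ⟨le_rfl, hL0⟩, rfl⟩
    have hSpos : 0 < sSup S :=
      (hpos 0 ⟨le_rfl, hL0⟩).trans_le (le_csSup hbdd ⟨0, ⟨le_rfl, hL0⟩, rfl⟩)
    obtain ⟨_, ⟨t₀, ht₀, rfl⟩, h⟩ := exists_lt_of_lt_csSup hne (half_lt_self hSpos)
    refine ⟨t₀, ht₀, fun t ht => ?_⟩
    have : bdryDist Ω (σ t) ≤ sSup S := le_csSup hbdd ⟨t, ht, rfl⟩
    dsimp only at h
    linarith
  have hexp : ∀ t ∈ Icc 0 L, bdryDist Ω (σ t) ≤ Real.exp (a - b * |t - t₀|) := by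
    intro t ht
    -- As `L < K(x, y) + 1`, every subarc exceeds the distance between its ends by at most `1`.
    have e1 : |t - t₀| ≤ 1 + kobDist Ω (σ t₀) (σ t) := by
      rcases le_total t₀ t with h | h
      · rw [abs_of_nonneg (sub_nonneg.2 h)]
        linarith [hleft t₀ ht₀, hright t ht, hΩ.triangle hx (hmem t₀ ht₀) hy,
          hΩ.triangle (hmem t₀ ht₀) (hmem t ht) hy]
      · rw [abs_of_nonpos (sub_nonpos.2 h), kobDist_comm]
        linarith [hleft t ht, hright t₀ ht₀, hΩ.triangle hx (hmem t ht) hy,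
          hΩ.triangle (hmem t ht) (hmem t₀ ht₀) hy]
    have e2 := hΩ.triangle (hmem t₀ ht₀) ho (hmem t ht)
    rw [kobDist_comm (σ t₀) o] at e2
    have e3 := hK _ (hmem t ht)
    have e4 := hK _ (hmem t₀ ht₀)
    have e5 : Real.log (bdryDist Ω (σ t)) ≤ Real.log 2 + Real.log (bdryDist Ω (σ t₀)) := by
      rw [← Real.log_mul two_ne_zero (hpos t₀ ht₀).ne']
      exact Real.log_le_log (hpos t ht) (hmax t ht)
    rw [one_div, Real.log_inv] at e3 e4
    rw [← Real.log_le_iff_le_exp (hpos t ht)]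
    have e6 : a - b * |t - t₀| = (2 * C + α * Real.log 2 + 1 - |t - t₀|) / (2 * α) := by
      rw [ha, hb]; ring
    rw [e6, le_div_iff₀ (by positivity)]
    nlinarith [mul_le_mul_of_nonneg_left e5 hα.le]
  -- Each side of `t₀` contributes at most `c / 3`, the left one through the reversed curve; the
  -- total `2c / 3` contradicts `c ≤ dist x y`.
  have d1 := hσ.dist_le (t₀ := t₀) hbpos.le ht₀.1 ht₀.2
    (fun t ht => (hltρ t ⟨ht₀.1.trans ht.1, ht.2⟩).le)
    (fun t ht => by
      have := hexp t ⟨ht₀.1.trans ht.1, ht.2⟩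
      rwa [abs_of_nonneg (sub_nonneg.2 ht.1)] at this) hsum
  have d2 := hσ.reverse.dist_le (t₀ := L - t₀) hbpos.le (sub_nonneg.2 ht₀.2)
    (by linarith [ht₀.1])
    (fun t ht => (hltρ (L - t) ⟨by linarith [ht.2], by linarith [ht.1, ht₀.1, ht₀.2]⟩).le)
    (fun t ht => by
      have := hexp (L - t) ⟨by linarith [ht.2], by linarith [ht.1, ht₀.1, ht₀.2]⟩
      rwa [abs_of_nonpos (by linarith [ht.1]),
        show -(L - t - t₀) = t - (L - t₀) by ring] at this) hsum
  simp only [sub_sub_cancel, sub_self, h0] at d2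
  rw [h1] at d1
  linarith [dist_triangle_left x y (σ t₀)]

/-! ### Iteration and convergence to the boundary -/

theorem kobDist_iterate_le {f : Ω → Ω}
    (hf : ∀ x y : Ω, kobDist Ω (f x) (f y) ≤ kobDist Ω x y) (n : ℕ) (x y : Ω) :
    kobDist Ω (f^[n] x) (f^[n] y) ≤ kobDist Ω x y := by
  induction n with
  | zero => exact le_rfl
  | succ n ih =>
    rw [Function.iterate_succ_apply', Function.iterate_succ_apply']
    exact (hf _ _).trans ih

theorem IsGoldilocks.tendsto_kobDist_iterate (hΩ : IsGoldilocks Ω) {f : Ω → Ω}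
    (hf : ∀ x y : Ω, kobDist Ω (f x) (f y) ≤ kobDist Ω x y) {o : Ω}
    (ho : Tendsto (fun n : ℕ => kobDist Ω (f^[n] o) o) atTop atTop) (p q : Ω) :
    Tendsto (fun n : ℕ => kobDist Ω (f^[n] p) q) atTop atTop := by
  refine tendsto_atTop_mono (fun n => ?_)
    (tendsto_atTop_add_const_right _ (-(kobDist Ω o p + kobDist Ω q o)) ho)
  have h1 := hΩ.triangle (f^[n] o).2 (f^[n] p).2 o.2
  have h2 := hΩ.triangle (f^[n] p).2 q.2 o.2
  have h3 := kobDist_iterate_le hf n o p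
  linarith

theorem IsGoldilocks.frontier_nonempty (hΩ : IsGoldilocks Ω) {o : Cn d} (ho : o ∈ Ω)
    {u : ℕ → Cn d} (hu : ∀ n, u n ∈ Ω)
    (hK : Tendsto (fun n => kobDist Ω (u n) o) atTop atTop) : (frontier Ω).Nonempty := by
  by_contra hne
  rw [not_nonempty_iff_eq_empty] at hne
  obtain ⟨C, α, -, -, h⟩ := hΩ.dist_le o ho
  obtain ⟨n, hn⟩ := (hK.eventually_gt_atTop C).exists
  have := h _ (hu n)
  -- With empty frontier, `bdryDist` is `0` and both `1 / 0` and `log 0` are `0`, so condition (2)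
  -- bounds the distance by `C`.
  simp only [bdryDist, hne, Metric.infDist_empty, div_zero, Real.log_zero, mul_zero, add_zero]
    at this
  rw [kobDist_comm] at this
  exact hn.not_ge this

/-- A sequence in a Goldilocks domain that escapes to infinity for the Kobayashi distance can only
converge to a boundary point. -/
theorem IsGoldilocks.mem_frontier_of_tendsto (hΩ : IsGoldilocks Ω) {o ξ : Cn d}
    (ho : o ∈ Ω) {u : ℕ → Cn d} (hu : ∀ n, u n ∈ Ω)
    (hK : Tendsto (fun n => kobDist Ω (u n) o) atTop atTop) (hξ : Tendsto u atTop (𝓝 ξ)) :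
    ξ ∈ frontier Ω := by
  rw [hΩ.isOpen.frontier_eq]
  refine ⟨mem_closure_of_tendsto hξ (Eventually.of_forall hu), fun hmem => ?_⟩
  obtain ⟨C, α, -, -, h⟩ := hΩ.dist_le o ho
  have hbd : Tendsto (fun n => bdryDist Ω (u n)) atTop (𝓝 (bdryDist Ω ξ)) :=
    ((Metric.continuous_infDist_pt _).tendsto ξ).comp hξ
  have hpos := hΩ.bdryDist_pos (hΩ.frontier_nonempty ho hu hK) hmem
  -- At an interior limit the upper bound from condition (2) converges, so the distances cannot
  -- diverge.
  have hlim := ((((tendsto_const_nhds (x := (1 : ℝ))).div hbd hpos.ne').log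
    (one_div_pos.2 hpos).ne').const_mul α).const_add C
  refine not_tendsto_atTop_of_tendsto_nhds hlim (tendsto_atTop_mono (fun n => ?_) hK)
  rw [kobDist_comm]
  exact h _ (hu n)

theorem IsGoldilocks.cauchySeq_iterate (hΩ : IsGoldilocks Ω) {f : Ω → Ω}
    (hf : ∀ x y : Ω, kobDist Ω (f x) (f y) ≤ kobDist Ω x y) {o : Ω}
    (ho : Tendsto (fun n : ℕ => kobDist Ω (f^[n] o) o) atTop atTop) :
    CauchySeq fun n : ℕ => ((f^[n] o : Ω) : Cn d) := by
  have hfr := hΩ.frontier_nonempty o.2 (fun n => (f^[n] o).2) ho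
  rw [Metric.cauchySeq_iff]
  intro ε hε
  obtain ⟨D, hD⟩ := hΩ.exists_add_le hfr o.2 (half_pos hε)
  obtain ⟨N, hN⟩ := eventually_atTop.1 (ho.eventually_gt_atTop D)
  have key : ∀ m ≥ N, ∀ n ≥ m, (∀ k < n, kobDist Ω (f^[k] o) o < kobDist Ω (f^[n] o) o) →
      dist ((f^[n] o : Ω) : Cn d) (f^[m] o : Ω) < ε / 2 := by
    intro m hm n hn hrec
    by_contra! hdist
    have h1 := hD _ (f^[n] o).2 _ (f^[m] o).2 hdist
    rw [kobDist_comm (o : Cn d)] at h1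
    have h2 : kobDist Ω (f^[n] o) (f^[m] o) ≤ kobDist Ω (f^[n - m] o) o := by
      obtain ⟨k, rfl⟩ := Nat.exists_eq_add_of_le hn
      rw [Function.iterate_add_apply, Nat.add_sub_cancel_left]
      exact kobDist_iterate_le hf m _ _
    have h3 : kobDist Ω (f^[n - m] o) o ≤ kobDist Ω (f^[n] o) o := by
      rcases (Nat.sub_le n m).eq_or_lt with h | h
      · rw [h]
      · exact (hrec _ h).le
    linarith [hN m hm]
  refine ⟨N, fun m hm m' hm' => ?_⟩
  -- One record time beyond both `m` and `m'` serves as a common reference point.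
  obtain ⟨n, hn, hrec⟩ := high_scores ho (max m m')
  have d1 := key m hm n ((le_max_left _ _).trans hn) hrec
  have d2 := key m' hm' n ((le_max_right _ _).trans hn) hrec
  linarith [dist_triangle_left ((f^[m] o : Ω) : Cn d) (f^[m'] o : Ω) (f^[n] o : Ω)]

/-- The two orbits stay within `K(o, x)` of each other while both escape, so their Gromov product
diverges. -/
theorem IsGoldilocks.tendsto_dist_iterate (hΩ : IsGoldilocks Ω) {f : Ω → Ω}
    (hf : ∀ x y : Ω, kobDist Ω (f x) (f y) ≤ kobDist Ω x y) {o : Ω}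
    (ho : Tendsto (fun n : ℕ => kobDist Ω (f^[n] o) o) atTop atTop) (x : Ω) :
    Tendsto (fun n : ℕ => dist ((f^[n] o : Ω) : Cn d) (f^[n] x : Ω)) atTop (𝓝 0) := by
  have hfr := hΩ.frontier_nonempty o.2 (fun n => (f^[n] o).2) ho
  rw [Metric.tendsto_atTop]
  intro ε hε
  obtain ⟨D, hD⟩ := hΩ.exists_add_le hfr o.2 hε
  obtain ⟨N, hN⟩ := eventually_atTop.1 (ho.eventually_gt_atTop (kobDist Ω o x + D))
  refine ⟨N, fun n hn => ?_⟩
  rw [Real.dist_0_eq_abs, abs_of_nonneg dist_nonneg]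
  by_contra! hdist
  have h1 := hD _ (f^[n] o).2 _ (f^[n] x).2 hdist
  linarith [hN n hn, kobDist_nonneg (Ω := Ω) (o : Cn d) (f^[n] x), kobDist_iterate_le hf n o x]

end Kobayashi

theorem theorem7 {d : ℕ} (Ω : Set (Kobayashi.Cn d)) (hΩ : Kobayashi.IsGoldilocks Ω)
    (f : Ω → Ω)
    (hf : ∀ x y : Ω, Kobayashi.kobDist Ω (f x) (f y) ≤ Kobayashi.kobDist Ω x y)
    (ho : ∃ o : Ω, Tendsto (fun n : ℕ => Kobayashi.kobDist Ω (f^[n] o) o) atTop atTop) :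
    (∀ o : Ω, Tendsto (fun n : ℕ => Kobayashi.kobDist Ω (f^[n] o) o) atTop atTop) ∧
      ∃ ξ ∈ frontier Ω, ∀ x : Ω,
        Tendsto (fun n : ℕ => ((f^[n] x : Ω) : Kobayashi.Cn d)) atTop (𝓝 ξ) := by
  obtain ⟨o, ho⟩ := ho
  refine ⟨fun p => hΩ.tendsto_kobDist_iterate hf ho p p, ?_⟩
  obtain ⟨ξ, hξ⟩ := cauchySeq_tendsto_of_complete (hΩ.cauchySeq_iterate hf ho)
  exact ⟨ξ, hΩ.mem_frontier_of_tendsto o.2 (fun n => (f^[n] o).2) ho hξ,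
    fun x => (tendsto_iff_of_dist (hΩ.tendsto_dist_iterate hf ho x)).1 hξ⟩
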